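/- Let $n\in\mathbb N$, let $A=\{1<2<\cdots<n\}$, and let $S_n=\langle A \mid cavb=acvb \ (a,b,c\in A,\ a\le b<c,\ v\in A^*)\rangle$ be the sylvester monoid of rank $n$. Let \[ L=A^*\setminus A^*\{cavb : a,b,c\in A,\ a\le b<c,\ v\in A^*\}A^* \] be the language of words that contain no left-hand side $cavb$ of a defining relation as a factor. Then $(A,L)$ is a biautomatic structure for $S_n$. That is: $A$ is a finite alphabet representing a generating set of $S_n$; $L$ is a regular language; every element of $S_n$ has at least one representative in $L$; and for every $a\in A\cup\{\varepsilon\}$, with \[ L_a=\{(u,v)\in L\times L : ua=_{S_n}v\},\qquad {}_aL=\{(u,v)\in L\times L : au=_{S_n}v\}, \] all four languages $L_a\delta_{\mathrm R}$, ${}_aL\,\delta_{\mathrm R}$, $L_a\delta_{\mathrm L}$ and ${}_aL\,\delta_{\mathrm L}$ are regular over the alphabet $(A\cup\{\$\})\times(A\cup\{\$\})$. Here $\$\notin A$ is a padding symbol; $\delta_{\mathrm R}$ maps a pair $(u,v)$ of words to the word of pairs of symbols obtained by appending symbols $\$$ on the right of the shorter of the two words until the lengths agree and then reading both words in parallel,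 and $\delta_{\mathrm L}$ is defined in the same way with the symbols $\$$ added on the left of the shorter word. -/

import Mathlib

/-! ### Biautomatic structures for monoids -/

/-- The element of the monoid `M` represented by the word `u` over the alphabet `A`, where the
letter `a` represents `f a`. -/
def wordEval {M A : Type*} [Monoid M] (f : A → M) (u : List A) : M :=
  (u.map f).prod

/-- The map `δ_R`: write two words one above the other, aligned on the left, the shorter one being
padded on the right. The padding symbol `$` is `none`, and a letter `a` is `some a`. -/
def padRight {A : Type*} (u v : List A) : List (Option A × Option A) :=
  List.zipWithAll Prod.mk u v

/-- The map `δ_L`: write two words one above the other, aligned on the right, the shorter one being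
padded on the left. -/
def padLeft {A : Type*} (u v : List A) : List (Option A × Option A) :=
  (padRight u.reverse v.reverse).reverse

/-- The language `R δ_R` over `(A ∪ {$}) × (A ∪ {$})`, for a relation `R` on words over `A`. -/
def padRightLanguage {A : Type*} (R : Set (List A × List A)) :
    Language (Option A × Option A) :=
  {w | ∃ u v, (u, v) ∈ R ∧ padRight u v = w}

/-- The language `R δ_L` over `(A ∪ {$}) × (A ∪ {$})`, for a relation `R` on words over `A`. -/
def padLeftLanguage {A : Type*} (R : Set (List A × List A)) :
    Language (Option A × Option A) :=
  {w | ∃ u v, (u, v) ∈ R ∧ padLeft u v = w}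

/-- The relation `L_x` of all pairs `(u, v)` of words in `L` such that `u x` and `v` represent the
same element of the monoid. -/
def rightMulRel {M A : Type*} [Monoid M] (f : A → M) (L : Language A) (x : List A) :
    Set (List A × List A) :=
  {p | p.1 ∈ L ∧ p.2 ∈ L ∧ wordEval f (p.1 ++ x) = wordEval f p.2}

/-- The relation `_x L` of all pairs `(u, v)` of words in `L` such that `x u` and `v` represent the
same element of the monoid. -/
def leftMulRel {M A : Type*} [Monoid M] (f : A → M) (L : Language A) (x : List A) :
    Set (List A × List A) :=
  {p | p.1 ∈ L ∧ p.2 ∈ L ∧ wordEval f (x ++ p.1) = wordEval f p.2}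

/-- `(A, L)` is a biautomatic structure for the monoid `M`, where the letters of `A` represent
elements of `M` through `f`. An element `a` of `A ∪ {ε}` is an `a : Option A`, and `a.toList` is
the corresponding word of length at most one. -/
structure IsBiautomaticStructure {M A : Type*} [Monoid M] (f : A → M) (L : Language A) :
    Prop where
  finite_alphabet : Finite A
  generates : Submonoid.closure (Set.range f) = ⊤
  regular : L.IsRegular
  exists_representative : ∀ m : M, ∃ u ∈ L, wordEval f u = m
  rightMul_padRight : ∀ a : Option A, (padRightLanguage (rightMulRel f L a.toList)).IsRegular
  leftMul_padRight : ∀ a : Option A, (padRightLanguage (leftMulRel f L a.toList)).IsRegular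
  rightMul_padLeft : ∀ a : Option A, (padLeftLanguage (rightMulRel f L a.toList)).IsRegular
  leftMul_padLeft : ∀ a : Option A, (padLeftLanguage (leftMulRel f L a.toList)).IsRegular

/-! ### The sylvester monoid -/

/-- The defining relations `(cavb, acvb)` of the sylvester monoid of rank `n`, where
`a ≤ b < c` are letters and `v` is a word over the ordered alphabet `Fin n`. -/
inductive SylvesterRel (n : ℕ) : FreeMonoid (Fin n) → FreeMonoid (Fin n) → Prop
  | intro (a b c : Fin n) (v : FreeMonoid (Fin n)) (hab : a ≤ b) (hbc : b < c) :
      SylvesterRel n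
        (FreeMonoid.of c * FreeMonoid.of a * v * FreeMonoid.of b)
        (FreeMonoid.of a * FreeMonoid.of c * v * FreeMonoid.of b)

/-- The sylvester monoid `S_n` of rank `n`. -/
abbrev SylvesterMonoid (n : ℕ) : Type :=
  PresentedMonoid (SylvesterRel n)

/-- The canonical map from the alphabet to the sylvester monoid. -/
def sylvesterGen (n : ℕ) : Fin n → SylvesterMonoid n :=
  PresentedMonoid.of (SylvesterRel n)

/-- The language of all words that have no factor `cavb` with `a ≤ b < c` letters and `v` a
word. -/
def sylvesterNormalForms (n : ℕ) : Language (Fin n) :=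
  {w | ∀ (a b c : Fin n) (v : List (Fin n)), a ≤ b → b < c →
    ¬ ([c, a] ++ v ++ [b]) <:+: w}

/-!
The sylvester monoid acts on words, a letter `a` acting by insertion from the left: it moves past
`z` as long as the rest of the word is `z ⋯ b ⋯` with `z ≤ b < a`. If `a u` is a normal form, then
inserting `a` into `u` gives `a u`. So acting on the empty word recovers a normal form from the
element it represents, and normal forms are unique.

In terms of normal forms, multiplying by `a` on the left moves the letter `a` past one block of
letters. Multiplying `u` by `a` on the right collects the letters at most `a` in front of the
letters greater than `a`; behind the first letter greater than `a` the small letters are pairwise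
distinct, so only boundedly many of them have to move, each past a block. Moving a letter past a
block is the relation `x D ↦ D x`, which a finite automaton recognises in parallel by remembering
one letter, and such relations between words of equal length are closed under composition,
concatenation and finite union.

Here `u a`, or `a u`, and the normal form of the product have equal lengths, and turning the letter
`a` into a padding symbol on either side of `u` is again the movement of a letter past a block.
Hence the same argument handles both kinds of padding.
-/

/-! ### Closure properties of regular languages -/

section RegularLanguages

variable {α β : Type*}

theorem isRegular_congr {L M : Language α} (h : ∀ w, w ∈ L ↔ w ∈ M) :
    L.IsRegular ↔ M.IsRegular :=
  iff_of_eq (congrArg _ (Language.ext h))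

theorem isRegular_of_finite_family {L : Language α} (F : Set (Language α)) (hF : F.Finite)
    (hL : L ∈ F) (hstep : ∀ K ∈ F, ∀ a, K.leftQuotient [a] ∈ F) : L.IsRegular := by
  refine Language.IsRegular.of_finite_range_leftQuotient (hF.subset ?_)
  rintro _ ⟨x, rfl⟩
  induction x using List.reverseRecOn with
  | nil => exact hL
  | append_singleton x a ih =>
    rw [Language.leftQuotient_append]
    exact hstep _ ih a

theorem leftQuotient_mem_range_leftQuotient {L K : Language α}
    (hK : K ∈ Set.range L.leftQuotient) (a : α) :
    K.leftQuotient [a] ∈ Set.range L.leftQuotient := by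
  obtain ⟨x, rfl⟩ := hK
  exact ⟨x ++ [a], L.leftQuotient_append x [a]⟩

theorem isRegular_iSup {ι : Type*} [Finite ι] {L : ι → Language α}
    (hL : ∀ i, (L i).IsRegular) : (⨆ i, L i).IsRegular := by
  refine Language.IsRegular.of_finite_range_leftQuotient
    (((Set.Finite.pi' fun i => (hL i).finite_range_leftQuotient).image
      fun K => ⨆ i, K i).subset ?_)
  rintro _ ⟨x, rfl⟩
  refine ⟨fun i => (L i).leftQuotient x, fun i => ⟨x, rfl⟩, ?_⟩
  ext w
  simp only [Language.mem_iSup, Language.mem_leftQuotient]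

theorem isRegular_preimage_map {L : Language β} (hL : L.IsRegular) (f : α → β) :
    Language.IsRegular (List.map f ⁻¹' L) := by
  obtain ⟨σ, _, M, rfl⟩ := hL
  exact ⟨σ, inferInstance, M.comap f, M.accepts_comap f⟩

theorem isRegular_map {L : Language α} (hL : L.IsRegular) (f : α → β) :
    (Language.map f L).IsRegular := by
  let imageUnion : Set (Language α) → Language β := fun T => ⨆ K ∈ T, Language.map f K
  refine isRegular_of_finite_family (imageUnion '' 𝒫 (Set.range L.leftQuotient))
    (hL.finite_range_leftQuotient.finite_subsets.image imageUnion)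
    ⟨{L}, by simpa using ⟨[], L.leftQuotient_nil⟩, by simp [imageUnion]⟩ ?_
  rintro _ ⟨T, hT, rfl⟩ b
  refine ⟨{K | ∃ J ∈ T, ∃ a, f a = b ∧ K = J.leftQuotient [a]}, ?_, ?_⟩
  · rintro _ ⟨J, hJ, a, -, rfl⟩
    exact leftQuotient_mem_range_leftQuotient (hT hJ) a
  · ext w
    simp only [imageUnion, Language.mem_iSup, Language.mem_leftQuotient]
    constructor
    · rintro ⟨_, ⟨J, hJ, a, rfl, rfl⟩, u, hu, rfl⟩
      exact ⟨J, hJ, a :: u, hu, rfl⟩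
    · rintro ⟨J, hJ, u, hu, huw⟩
      obtain ⟨a, v, rfl, rfl, rfl⟩ := List.map_eq_cons_iff.1 huw
      exact ⟨_, ⟨J, hJ, a, rfl, rfl⟩, v, hu, rfl⟩

theorem leftQuotient_mul_singleton (K M : Language α) (a : α) :
    (K * M).leftQuotient [a] =
      K.leftQuotient [a] * M + ⨆ _ : [] ∈ K, M.leftQuotient [a] := by
  ext w
  simp only [Language.mem_leftQuotient, Language.mem_add, Language.mem_mul, Language.mem_iSup,
    List.singleton_append, exists_prop]
  constructor
  · rintro ⟨_ | ⟨x, u⟩, hu, v, hv, h⟩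
    · exact .inr ⟨hu, h ▸ hv⟩
    · obtain ⟨rfl, rfl⟩ := List.cons_eq_cons.1 h
      exact .inl ⟨u, hu, v, hv, rfl⟩
  · rintro (⟨u, hu, v, hv, rfl⟩ | ⟨hK, hw⟩)
    · exact ⟨a :: u, hu, v, hv, rfl⟩
    · exact ⟨[], hK, a :: w, hw, rfl⟩

theorem isRegular_mul {L M : Language α} (hL : L.IsRegular) (hM : M.IsRegular) :
    (L * M).IsRegular := by
  let mulAddUnion : Language α × Set (Language α) → Language α :=
    fun p => p.1 * M + ⨆ N ∈ p.2, N
  refine isRegular_of_finite_family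
    (mulAddUnion '' (Set.range L.leftQuotient ×ˢ 𝒫 (Set.range M.leftQuotient)))
    ((hL.finite_range_leftQuotient.prod hM.finite_range_leftQuotient.finite_subsets).image _)
    ⟨(L, ∅), ⟨⟨[], L.leftQuotient_nil⟩, Set.empty_subset _⟩, ?_⟩ ?_
  · ext w
    simp only [mulAddUnion, Language.mem_add, Language.mem_iSup, Set.mem_empty_iff_false,
      exists_prop, false_and, exists_false, or_false]
  · rintro _ ⟨⟨K, T⟩, ⟨hK, hT⟩, rfl⟩ a
    refine ⟨(K.leftQuotient [a],
      {J | [] ∈ K ∧ J = M.leftQuotient [a]} ∪ (·.leftQuotient [a]) '' T),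
      ⟨leftQuotient_mem_range_leftQuotient hK a, ?_⟩, ?_⟩
    · rintro _ (⟨-, rfl⟩ | ⟨N, hN, rfl⟩)
      · exact ⟨[a], rfl⟩
      · exact leftQuotient_mem_range_leftQuotient (hT hN) a
    · ext w
      have hKM := congrArg (w ∈ ·) (leftQuotient_mul_singleton K M a)
      simp only [Language.mem_leftQuotient, Language.mem_add, Language.mem_iSup] at hKM
      simp only [mulAddUnion, Language.mem_leftQuotient, Language.mem_add, Language.mem_iSup, hKM,
        Set.mem_union, Set.mem_ofPred_eq, Set.mem_image, exists_prop]
      grind [Language.mem_leftQuotient]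

theorem isRegular_singleton (w : List α) : Language.IsRegular ({w} : Set (List α)) := by
  refine isRegular_of_finite_family (insert 0 ((fun v => ({v} : Set (List α))) '' {v | v <:+ w}))
    ((((List.finite_toSet w.tails).subset fun v => (List.mem_tails v w).2).image _).insert 0)
    (.inr ⟨w, List.suffix_refl w, rfl⟩) ?_
  rintro _ (rfl | ⟨v, hv, rfl⟩) a
  · exact .inl rfl
  · by_cases h : ∃ u, v = a :: u
    · obtain ⟨u, rfl⟩ := h
      refine .inr ⟨u, (List.suffix_cons a u).trans hv, ?_⟩
      ext x
      exact ⟨congrArg (a :: ·), List.tail_eq_of_cons_eq⟩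
    · refine .inl (Set.eq_empty_of_forall_notMem fun u hu => h ⟨u, Eq.symm hu⟩)

/-- Reading a letter adds a condition on the pairs and one on the letters that follow, and there are
finitely many of either. -/
theorem isRegular_triplewise [Finite α] (T : α → α → α → Prop) :
    Language.IsRegular {w : List α | w.Triplewise T} := by
  let constrained : (α → α → Prop) × (α → Prop) → Language α :=
    fun c => {w | w.Triplewise T ∧ w.Pairwise c.1 ∧ ∀ x ∈ w, c.2 x}
  refine isRegular_of_finite_family (insert 0 (Set.range constrained)) (Set.toFinite _)
    (.inr ⟨(fun _ _ => True, fun _ => True), ?_⟩) ?_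
  · exact Set.ext fun w => and_iff_left ⟨List.pairwise_of_forall fun _ _ => trivial, by simp⟩
  · rintro _ (rfl | ⟨⟨P, Q⟩, rfl⟩) a
    · exact .inl rfl
    · by_cases ha : Q a
      · refine .inr ⟨(fun x y => P x y ∧ T a x y, fun x => Q x ∧ P a x), ?_⟩
        ext w
        change w.Triplewise T ∧ w.Pairwise (fun x y => P x y ∧ T a x y) ∧ (∀ x ∈ w, Q x ∧ P a x) ↔
          (a :: w).Triplewise T ∧ (a :: w).Pairwise P ∧ ∀ x ∈ a :: w, Q x
        simp only [List.triplewise_cons, List.pairwise_cons, List.pairwise_and_iff,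
          List.forall_mem_cons, forall_and]
        tauto
      · exact .inl (Set.eq_empty_of_forall_notMem fun w hw => ha (hw.2.2 a (by simp)))

theorem isRegular_forall_mem (p : α → Prop) :
    Language.IsRegular {w : List α | ∀ x ∈ w, p x} := by
  refine isRegular_of_finite_family (insert 0 {{w | ∀ x ∈ w, p x}})
    ((Set.finite_singleton _).insert 0) (.inr rfl) ?_
  rintro _ (rfl | rfl) a
  · exact .inl rfl
  · by_cases ha : p a
    · refine .inr (Set.ext fun w => ?_)
      change (∀ x ∈ a :: w, p x) ↔ ∀ x ∈ w, p x
      simp only [List.forall_mem_cons, ha, true_and]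
    · exact .inl (Set.eq_empty_of_forall_notMem fun w hw => ha (hw a (by simp)))

theorem isRegular_univ : Language.IsRegular (Set.univ : Set (List α)) := by
  simpa using isRegular_forall_mem (fun _ : α => True)

theorem isRegular_setOf_mem (a : α) : Language.IsRegular {w : List α | a ∈ w} := by
  have hcompl : {w : List α | a ∈ w} = {w | ∀ x ∈ w, x ≠ a}ᶜ := by
    ext w
    simp
  exact hcompl ▸ (isRegular_forall_mem (· ≠ a)).compl

end RegularLanguages

/-! ### Synchronously regular relations -/

section SyncRegular

open scoped SetRel

variable {α β γ : Type*}

/-- A synchronously regular (letter-to-letter) relation between words: its pairs have equal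
lengths and, read in parallel, form a regular language over the alphabet of pairs. -/
structure SyncRegular (R : SetRel (List α) (List β)) : Prop where
  length_eq : ∀ p ∈ R, p.1.length = p.2.length
  isRegular : Language.IsRegular {w : List (α × β) | (w.map Prod.fst, w.map Prod.snd) ∈ R}

/-- The product `R · S` of two relations between words: concatenate a pair of `R` with a pair of
`S`, componentwise. -/
def appendRel (R S : SetRel (List α) (List β)) : SetRel (List α) (List β) :=
  Set.image2 (fun p q => (p.1 ++ q.1, p.2 ++ q.2)) R S

theorem exists_map_fst_map_snd {s : List α} {t : List β} (hst : s.length = t.length) :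
    ∃ w : List (α × β), w.map Prod.fst = s ∧ w.map Prod.snd = t :=
  ⟨s.zip t, List.map_fst_zip hst.le, List.map_snd_zip hst.ge⟩

namespace SyncRegular

variable {R S : SetRel (List α) (List β)}

theorem image_map_map {L : Language γ} (hL : L.IsRegular) (f : γ → α) (g : γ → β) :
    SyncRegular ((fun u => (u.map f, u.map g)) '' L) where
  length_eq := by
    rintro _ ⟨u, -, rfl⟩
    simp
  isRegular := by
    refine (isRegular_congr fun w => ?_).2 (isRegular_map hL fun c => (f c, g c))
    constructor
    · rintro ⟨u, hu, h⟩
      rw [Prod.mk.injEq] at h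
      exact ⟨u, hu, by rw [List.zip_of_prod h.1.symm h.2.symm, List.zip_map']⟩
    · rintro ⟨u, hu, rfl⟩
      exact ⟨u, hu, by simp [Function.comp_def]⟩

theorem diagonal {L : Language α} (hL : L.IsRegular) : SyncRegular ((fun u => (u, u)) '' L) := by
  simpa using image_map_map hL id id

theorem singleton {s : List α} {t : List β} (hst : s.length = t.length) :
    SyncRegular {(s, t)} where
  length_eq := by simpa using hst
  isRegular := by
    refine (isRegular_congr fun w => ?_).2 (isRegular_singleton (s.zip t))
    change (_, _) = (s, t) ↔ w = s.zip t
    constructor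
    · intro h
      exact List.zip_of_prod (congrArg Prod.fst h) (congrArg Prod.snd h)
    · rintro rfl
      rw [List.map_fst_zip hst.le, List.map_snd_zip hst.ge]

theorem inv (hR : SyncRegular R) : SyncRegular R.inv where
  length_eq := fun p hp => (hR.length_eq p.swap hp).symm
  isRegular := by
    refine (isRegular_congr fun w => ?_).2 (isRegular_preimage_map hR.isRegular Prod.swap)
    change (w.map Prod.snd, w.map Prod.fst) ∈ R ↔
      ((w.map Prod.swap).map Prod.fst, (w.map Prod.swap).map Prod.snd) ∈ R
    simp only [List.map_map, Function.comp_def, Prod.fst_swap, Prod.snd_swap]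

theorem comp {T : SetRel (List β) (List γ)} (hR : SyncRegular R) (hT : SyncRegular T) :
    SyncRegular (R ○ T) where
  length_eq := by
    rintro ⟨s, r⟩ ⟨m, hsm, hmr⟩
    exact (hR.length_eq _ hsm).trans (hT.length_eq _ hmr)
  isRegular := by
    refine (isRegular_congr fun w => ?_).2 (isRegular_map
      (((isRegular_preimage_map hR.isRegular Prod.fst).inf
        (isRegular_preimage_map hT.isRegular Prod.snd)).inf
        (isRegular_forall_mem fun q : (α × β) × β × γ => q.1.2 = q.2.1))
      fun q => (q.1.1, q.2.2))
    constructor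
    · rintro ⟨m, hwm, hmw⟩
      obtain ⟨t, ht, rfl⟩ := exists_map_fst_map_snd
        (show w.length = m.length by simpa using hR.length_eq _ hwm)
      refine ⟨t.map fun q => ((q.1.1, q.2), (q.2, q.1.2)), ⟨⟨?_, ?_⟩, ?_⟩, ?_⟩
      · change (_, _) ∈ R
        simpa [← ht, Function.comp_def] using hwm
      · change (_, _) ∈ T
        simpa [← ht, Function.comp_def] using hmw
      · simp
      · simpa [Function.comp_def] using ht
    · rintro ⟨t, ⟨⟨htR, htT⟩, ht⟩, rfl⟩
      have hmid : t.map (·.1.2) = t.map (·.2.1) := List.map_congr_left ht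
      refine ⟨t.map (·.1.2), ?_, ?_⟩
      · simpa [Function.comp_def] using htR
      · simpa [hmid, Function.comp_def] using htT

theorem union (hR : SyncRegular R) (hS : SyncRegular S) : SyncRegular (R ∪ S) where
  length_eq := by
    rintro p (hp | hp)
    exacts [hR.length_eq p hp, hS.length_eq p hp]
  isRegular := hR.isRegular.add hS.isRegular

theorem iUnion {ι : Type*} [Finite ι] {R : ι → SetRel (List α) (List β)}
    (hR : ∀ i, SyncRegular (R i)) : SyncRegular (⋃ i, R i) where
  length_eq := by
    intro p hp
    obtain ⟨i, hi⟩ := Set.mem_iUnion.1 hp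
    exact (hR i).length_eq p hi
  isRegular := by
    refine (isRegular_congr fun w => ?_).2 (isRegular_iSup fun i => (hR i).isRegular)
    refine .trans ?_ Language.mem_iSup.symm
    exact Set.mem_iUnion

theorem append (hR : SyncRegular R) (hS : SyncRegular S) : SyncRegular (appendRel R S) where
  length_eq := by
    rintro _ ⟨p, hp, q, hq, rfl⟩
    simp [hR.length_eq p hp, hS.length_eq q hq]
  isRegular := by
    refine (isRegular_congr fun w => ?_).2 (isRegular_mul hR.isRegular hS.isRegular)
    constructor
    · rintro ⟨⟨s, t⟩, hst, ⟨s', t'⟩, hst', h⟩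
      obtain ⟨v, rfl, rfl⟩ := exists_map_fst_map_snd (hR.length_eq _ hst)
      obtain ⟨v', rfl, rfl⟩ := exists_map_fst_map_snd (hS.length_eq _ hst')
      refine ⟨v, hst, v', hst', ?_⟩
      rw [Prod.mk.injEq] at h
      change v ++ v' = w
      rw [List.zip_of_prod h.1.symm h.2.symm, ← List.map_append, ← List.map_append]
      exact List.zip_of_prod rfl rfl
    · rintro ⟨v, hv, v', hv', rfl⟩
      exact ⟨_, hv, _, hv', by simp⟩

theorem restrict (hR : SyncRegular R) {L : Language α} {M : Language β} (hL : L.IsRegular)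
    (hM : M.IsRegular) : SyncRegular {p ∈ R | p.1 ∈ L ∧ p.2 ∈ M} where
  length_eq := fun p hp => hR.length_eq p hp.1
  isRegular := hR.isRegular.inf
    ((isRegular_preimage_map hL Prod.fst).inf (isRegular_preimage_map hM Prod.snd))

theorem shift [Finite α] {x y : List α} (hxy : x.length = y.length) :
    SyncRegular {p : List α × List α | x ++ p.2 = p.1 ++ y} := by
  let shiftLanguage : List α → Language (α × α) :=
    fun z => {w | z ++ w.map Prod.snd = w.map Prod.fst ++ y}
  refine ⟨fun p hp => ?_, isRegular_of_finite_family
    (insert 0 (shiftLanguage '' {z | z.length = y.length}))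
    (((List.finite_length_eq α y.length).image _).insert 0) (.inr ⟨x, hxy, rfl⟩) ?_⟩
  · have hlen := congrArg List.length (show x ++ p.2 = p.1 ++ y from hp)
    simp only [List.length_append] at hlen
    lia
  · rintro _ (rfl | ⟨z, hz, rfl⟩) ⟨a, b⟩
    · exact .inl rfl
    obtain ⟨c, z', hz'⟩ := List.exists_cons_of_ne_nil (List.concat_ne_nil b z)
    by_cases hca : c = a
    · have hlen : z'.length = z.length := by simpa using (congrArg List.length hz').symm
      refine .inr ⟨z', hlen.trans hz, Language.ext fun w => ?_⟩
      change z' ++ w.map Prod.snd = w.map Prod.fst ++ y ↔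
        z ++ b :: w.map Prod.snd = a :: (w.map Prod.fst ++ y)
      rw [List.append_cons, hz', hca, List.cons_append, List.cons_inj_right]
    · refine .inl (Set.eq_empty_of_forall_notMem fun w hw => hca ?_)
      have hw' : z ++ b :: w.map Prod.snd = a :: (w.map Prod.fst ++ y) := hw
      rw [List.append_cons, hz', List.cons_append] at hw'
      exact (List.cons.inj hw').1

theorem rotation [Finite α] {L : Language α} (hL : L.IsRegular) (x : List α) :
    SyncRegular ((fun u => (x ++ u, u ++ x)) '' L) := by
  convert (shift (rfl : x.length = x.length)).restrict
    (isRegular_mul (isRegular_singleton x) hL) isRegular_univ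
  ext ⟨s, t⟩
  constructor
  · rintro ⟨u, hu, h⟩
    obtain ⟨rfl, rfl⟩ := Prod.mk.inj h
    exact ⟨by simp, ⟨_, rfl, u, hu, rfl⟩, trivial⟩
  · rintro ⟨hshift, ⟨y, hy, u, hu, rfl⟩, -⟩
    obtain rfl : x = y := Eq.symm hy
    refine ⟨u, hu, Prod.ext rfl ?_⟩
    have h : x ++ t = (x ++ u) ++ x := hshift
    simpa using h.symm

theorem extract_filter [Finite α] (p : α → Bool) {l : List α} (hl : ∀ x ∈ l, p x) :
    SyncRegular ((fun t => (t, l ++ t.filter (!p ·))) '' {t | t.filter p = l}) := by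
  induction l with
  | nil =>
    convert diagonal (isRegular_forall_mem fun x => p x = false) using 1
    have hnil : {t : List α | t.filter p = []} = {t | ∀ x ∈ t, p x = false} := by
      ext t
      simp
    rw [hnil]
    exact Set.image_congr fun t ht =>
      Prod.ext rfl (List.filter_eq_self.2 fun x hx => by simp [ht x hx])
  | cons x l ih =>
    obtain ⟨hx, hl⟩ := List.forall_mem_cons.1 hl
    -- A rotation brings the first letter `x` to the front, past the block `D` that precedes it.
    have hfirst : SyncRegular (appendRel
        (SetRel.inv ((fun u => ([x] ++ u, u ++ [x])) '' {D : List α | ∀ d ∈ D, p d = false}))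
        ((fun u => (u, u)) '' Set.univ)) :=
      (rotation (isRegular_forall_mem _) [x]).inv.append (diagonal isRegular_univ)
    convert hfirst.comp ((singleton (rfl : [x].length = [x].length)).append (ih hl))
    ext q
    constructor
    · rintro ⟨t, ht, rfl⟩
      obtain ⟨D, s, rfl, hD, -, rfl⟩ := List.filter_eq_cons_iff.1 ht
      have hD' : ∀ d ∈ D, p d = false := by simpa using hD
      refine ⟨x :: D ++ s,
        ⟨(D ++ [x], x :: D), ⟨D, hD', rfl⟩, (s, s), ⟨s, trivial, rfl⟩, by simp⟩,
        ⟨([x], [x]), rfl, _, ⟨D ++ s, ?_, rfl⟩, ?_⟩⟩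
      · simp [List.filter_eq_nil_iff.2 hD]
      · simp [hx]
    · obtain ⟨u, v⟩ := q
      rintro ⟨m, ⟨⟨_, _⟩, ⟨D, hD, hDx⟩, _, ⟨s, -, rfl⟩, hm⟩, ⟨_, rfl, _, ⟨r, hr, rfl⟩, hrv⟩⟩
      have hDnil : D.filter p = [] := by simpa using hD
      obtain ⟨rfl, rfl⟩ := Prod.mk.inj hDx
      obtain ⟨rfl, rfl⟩ := Prod.mk.inj hm
      obtain ⟨hDr, rfl⟩ := Prod.mk.inj hrv
      obtain rfl : r = D ++ s := by simpa using hDr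
      have hr' : s.filter p = l := by simpa [hDnil] using hr
      refine ⟨_, ?_, Prod.ext rfl ?_⟩
      · simp [hDnil, hx, hr']
      · simp [hx]

theorem partition_filter [Finite α] (p : α → Bool) (k : ℕ) {L : Language α} (hL : L.IsRegular)
    (hsplit : ∀ u ∈ L, ∃ s t, u = s ++ t ∧ (∀ x ∈ s, p x) ∧ (t.filter p).length ≤ k) :
    SyncRegular ((fun u => (u, u.filter p ++ u.filter (!p ·))) '' L) := by
  have hfinite : Finite {l : List α // l.length ≤ k ∧ ∀ x ∈ l, p x} :=
    ((List.finite_length_le α k).subset fun l hl => hl.1).to_subtype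
  convert (iUnion fun l : {l : List α // l.length ≤ k ∧ ∀ x ∈ l, p x} =>
    (diagonal (isRegular_forall_mem (p ·))).append (extract_filter p l.2.2)).restrict
      hL isRegular_univ
  have hfilter : ∀ {s t : List α}, (∀ x ∈ s, p x) →
      (s ++ t).filter p ++ (s ++ t).filter (!p ·) = s ++ (t.filter p ++ t.filter (!p ·)) := by
    intro s t hs
    have hs' : s.filter (!p ·) = [] := by simpa using hs
    simp [List.filter_eq_self.2 hs, hs']
  ext q
  constructor
  · rintro ⟨u, hu, rfl⟩
    obtain ⟨s, t, rfl, hs, ht⟩ := hsplit u hu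
    exact ⟨Set.mem_iUnion.2 ⟨⟨t.filter p, ht, by simp⟩,
      (s, s), ⟨s, hs, rfl⟩, _, ⟨t, rfl, rfl⟩, Prod.ext rfl (hfilter hs).symm⟩, hu, trivial⟩
  · rintro ⟨h, hu, -⟩
    obtain ⟨⟨l, hl⟩, _, ⟨s, hs, rfl⟩, _, ⟨t, rfl, rfl⟩, rfl⟩ := Set.mem_iUnion.1 h
    exact ⟨s ++ t, hu, Prod.ext rfl (hfilter hs)⟩

theorem reencode_left {δ ε : Type*} {σ : δ → List α} {τ : δ → List β} {f : ε → List γ}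
    {R : Set (δ × ε)} (hR : SyncRegular (Prod.map τ f '' R)) (hτ : Function.Injective τ)
    (hστ : SyncRegular (Set.range fun u => (σ u, τ u))) :
    SyncRegular (Prod.map σ f '' R) := by
  convert hστ.comp hR
  ext p
  constructor
  · rintro ⟨⟨u, v⟩, huv, rfl⟩
    exact ⟨τ u, ⟨u, rfl⟩, (u, v), huv, rfl⟩
  · obtain ⟨s, t⟩ := p
    rintro ⟨_, ⟨u, h⟩, ⟨u', v⟩, huv, h'⟩
    obtain ⟨rfl, rfl⟩ := Prod.mk.inj h
    obtain ⟨hu, rfl⟩ := Prod.mk.inj h'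
    exact ⟨(u, v), hτ hu ▸ huv, rfl⟩

theorem map_right (hR : SyncRegular R) (g : β → γ) :
    SyncRegular (Prod.map id (List.map g) '' R) := by
  convert hR.comp (image_map_map isRegular_univ id g)
  ext ⟨s, r⟩
  constructor
  · rintro ⟨⟨s, t⟩, hst, h⟩
    obtain ⟨rfl, rfl⟩ := Prod.mk.inj h
    exact ⟨t, hst, t, trivial, by simp⟩
  · rintro ⟨t, hst, t', -, h⟩
    obtain ⟨ht, rfl⟩ := Prod.mk.inj h
    obtain rfl : t' = t := by simpa using ht
    exact ⟨(s, t'), hst, rfl⟩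

theorem isRegular_setOf_eq_zip {δ ε : Type*} {R : Set (δ × ε)} {σ : δ → List α}
    {τ : ε → List β} (hR : SyncRegular (Prod.map σ τ '' R)) {pad : δ → ε → List (α × β)}
    (hpad : ∀ u v, (σ u).length = (τ v).length → pad u v = (σ u).zip (τ v)) :
    Language.IsRegular {w | ∃ u v, (u, v) ∈ R ∧ pad u v = w} := by
  refine (isRegular_congr fun w => ?_).2 hR.isRegular
  constructor
  · rintro ⟨u, v, huv, rfl⟩
    have hlen := hR.length_eq (σ u, τ v) ⟨_, huv, rfl⟩
    change (_, _) ∈ Prod.map σ τ '' R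
    rw [hpad u v hlen, List.map_fst_zip hlen.le, List.map_snd_zip hlen.ge]
    exact ⟨_, huv, rfl⟩
  · rintro ⟨⟨u, v⟩, huv, h⟩
    rw [Prod.map_apply, Prod.mk.injEq] at h
    have hlen : (σ u).length = (τ v).length := by simp [h]
    exact ⟨u, v, huv, (hpad u v hlen).trans (List.zip_of_prod h.1.symm h.2.symm).symm⟩

end SyncRegular

end SyncRegular

/-! ### Padding -/

section Padding

variable {A : Type*}

/-- The word `u$^k`, with `$ = none`. -/
def appendPadding (k : ℕ) (u : List A) : List (Option A) :=
  u.map some ++ List.replicate k none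

/-- The word `$^k u`, with `$ = none`. -/
def prependPadding (k : ℕ) (u : List A) : List (Option A) :=
  List.replicate k none ++ u.map some

theorem prependPadding_injective (k : ℕ) :
    Function.Injective (prependPadding k : List A → List (Option A)) :=
  (List.append_right_injective _).comp (List.map_injective_iff.2 (Option.some_injective A))

theorem appendPadding_injective (k : ℕ) :
    Function.Injective (appendPadding k : List A → List (Option A)) :=
  (List.append_left_injective _).comp (List.map_injective_iff.2 (Option.some_injective A))

theorem padRight_eq_zip {u v : List A} {k : ℕ} (h : u.length + k = v.length) :
    padRight u v = (appendPadding k u).zip (v.map some) := by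
  induction u generalizing v with
  | nil =>
    obtain rfl : k = v.length := by simpa using h
    simp [padRight, appendPadding, ← List.map_const', List.zip_map']
  | cons a u ih =>
    obtain _ | ⟨b, v⟩ := v
    · simp at h
    · simpa [padRight, appendPadding] using ih (v := v) (by simpa [Nat.add_right_comm] using h)

theorem padLeft_eq_zip {u v : List A} {k : ℕ} (h : u.length + k = v.length) :
    padLeft u v = (prependPadding k u).zip (v.map some) := by
  rw [padLeft, padRight_eq_zip (k := k) (by simpa using h), List.zip,
    List.reverse_zipWith (by simp [appendPadding, h])]
  simp [appendPadding, prependPadding]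

theorem syncRegular_prependPadding_appendPadding [Finite A] (k : ℕ) :
    SyncRegular (Set.range fun u : List A => (prependPadding k u, appendPadding k u)) := by
  convert SyncRegular.rotation (isRegular_map isRegular_univ (some : A → Option A))
    (List.replicate k none)
  change _ = _ '' (List.map some '' Set.univ)
  rw [Set.image_univ, ← Set.range_comp]
  rfl

theorem syncRegular_appendPadding_prependPadding [Finite A] (k : ℕ) :
    SyncRegular (Set.range fun u : List A => (appendPadding k u, prependPadding k u)) := by
  convert (syncRegular_prependPadding_appendPadding (A := A) k).inv
  rw [SetRel.inv, ← Set.image_swap_eq_preimage_swap, ← Set.range_comp]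
  rfl

theorem syncRegular_appendPadding_append (x : List A) :
    SyncRegular (Set.range fun u : List A => (appendPadding x.length u, u ++ x)) := by
  convert (SyncRegular.image_map_map (isRegular_univ (α := A)) some id).append
    (SyncRegular.singleton (List.length_replicate (n := x.length) (a := (none : Option A))))
  simp only [appendRel, Set.image2_singleton_right, Set.image_univ, ← Set.range_comp]
  simp [Function.comp_def, appendPadding]

theorem syncRegular_prependPadding_append (x : List A) :
    SyncRegular (Set.range fun u : List A => (prependPadding x.length u, x ++ u)) := by
  convert (SyncRegular.singleton
    (List.length_replicate (n := x.length) (a := (none : Option A)))).append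
    (SyncRegular.image_map_map (isRegular_univ (α := A)) some id)
  simp only [appendRel, Set.image2_singleton_left, Set.image_univ, ← Set.range_comp]
  simp [Function.comp_def, prependPadding]

variable {R : Set (List A × List A)}

theorem isRegular_padLanguages_of_prependPadding [Finite A] {k : ℕ}
    (hR : SyncRegular (Prod.map (prependPadding k) (List.map some) '' R)) :
    (padRightLanguage R).IsRegular ∧ (padLeftLanguage R).IsRegular := by
  refine ⟨?_, hR.isRegular_setOf_eq_zip fun u v h =>
    padLeft_eq_zip (by simpa [prependPadding, add_comm] using h)⟩
  have hR' : SyncRegular (Prod.map (appendPadding k) (List.map some) '' R) :=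
    hR.reencode_left (prependPadding_injective k) (syncRegular_appendPadding_prependPadding k)
  exact hR'.isRegular_setOf_eq_zip fun u v h =>
    padRight_eq_zip (by simpa [appendPadding] using h)

theorem isRegular_padLanguages_of_append_left [Finite A] {x : List A}
    (hR : SyncRegular (Prod.map (x ++ ·) id '' R)) :
    (padRightLanguage R).IsRegular ∧ (padLeftLanguage R).IsRegular := by
  have hR' : SyncRegular (Prod.map (x ++ ·) (List.map some) '' R) := by
    simpa [Set.image_image, Prod.map_map] using hR.map_right some
  exact isRegular_padLanguages_of_prependPadding
    (hR'.reencode_left (List.append_right_injective x) (syncRegular_prependPadding_append x))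

theorem isRegular_padLanguages_of_append_right [Finite A] {x : List A}
    (hR : SyncRegular (Prod.map (· ++ x) id '' R)) :
    (padRightLanguage R).IsRegular ∧ (padLeftLanguage R).IsRegular := by
  have hR' : SyncRegular (Prod.map (· ++ x) (List.map some) '' R) := by
    simpa [Set.image_image, Prod.map_map] using hR.map_right some
  have hR'' : SyncRegular (Prod.map (appendPadding x.length) (List.map some) '' R) :=
    hR'.reencode_left (List.append_left_injective x) (syncRegular_appendPadding_append x)
  exact isRegular_padLanguages_of_prependPadding (hR''.reencode_left
    (appendPadding_injective _) (syncRegular_prependPadding_appendPadding _))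

theorem isBiautomaticStructure_of_syncRegular {M : Type*} [Monoid M] [Finite A] {f : A → M}
    {L : Language A} (hgen : Submonoid.closure (Set.range f) = ⊤) (hL : L.IsRegular)
    (hrep : ∀ m, ∃ u ∈ L, wordEval f u = m)
    (hright : ∀ a : Option A,
      SyncRegular (Prod.map (· ++ a.toList) id '' rightMulRel f L a.toList))
    (hleft : ∀ a : Option A,
      SyncRegular (Prod.map (a.toList ++ ·) id '' leftMulRel f L a.toList)) :
    IsBiautomaticStructure f L where
  finite_alphabet := inferInstance
  generates := hgen
  regular := hL
  exists_representative := hrep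
  rightMul_padRight a := (isRegular_padLanguages_of_append_right (hright a)).1
  leftMul_padRight a := (isRegular_padLanguages_of_append_left (hleft a)).1
  rightMul_padLeft a := (isRegular_padLanguages_of_append_right (hright a)).2
  leftMul_padLeft a := (isRegular_padLanguages_of_append_left (hleft a)).2

end Padding

/-! ### Insertion into sylvester normal forms -/

section SylvesterInsert

variable {α : Type*} [LinearOrder α]

/-- A word is in sylvester normal form if it has no subsequence `c a b` with `a ≤ b < c`. -/
def IsSylvesterNormal (w : List α) : Prop :=
  w.Triplewise fun c a b => a ≤ b → c ≤ b

/-- Insertion of a letter on the left of a word in sylvester normal form: the letter `a` moves past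
`z` as long as the remaining word is `z ⋯ b ⋯` with `z ≤ b < a`. -/
def sylvesterInsert (a : α) : List α → List α
  | [] => [a]
  | z :: y => if ∃ b ∈ y, z ≤ b ∧ b < a then z :: sylvesterInsert a y else a :: z :: y

theorem IsSylvesterNormal.sublist {u w : List α} (hw : IsSylvesterNormal w) (h : u.Sublist w) :
    IsSylvesterNormal u := by
  induction h with
  | slnil => exact hw
  | cons _ _ ih => exact ih (List.triplewise_cons.1 hw).2
  | cons_cons _ h ih =>
    obtain ⟨h₁, h₂⟩ := List.triplewise_cons.1 hw
    exact List.triplewise_cons.2 ⟨h₁.sublist h, ih h₂⟩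

theorem sylvesterInsert_perm (a : α) (u : List α) : (sylvesterInsert a u).Perm (a :: u) := by
  induction u with
  | nil => rfl
  | cons z y ih =>
    rw [sylvesterInsert]
    split_ifs
    · exact (ih.cons z).trans (.swap a z y)
    · rfl

theorem mem_sylvesterInsert {a b : α} {u : List α} : b ∈ sylvesterInsert a u ↔ b = a ∨ b ∈ u :=
  (sylvesterInsert_perm a u).mem_iff.trans List.mem_cons

theorem IsSylvesterNormal.sylvesterInsert_eq_cons {a : α} {u : List α}
    (h : IsSylvesterNormal (a :: u)) : sylvesterInsert a u = a :: u := by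
  obtain _ | ⟨z, y⟩ := u
  · rfl
  · refine if_neg ?_
    rintro ⟨b, hb, hzb, hba⟩
    exact ((List.pairwise_cons.1 (List.triplewise_cons.1 h).1).1 b hb hzb).not_gt hba

theorem pairwise_sylvesterInsert {r : α → α → Prop} {a : α} {u : List α} (hu : u.Pairwise r)
    (ha : ∀ x ∈ u, r x a ∧ r a x) : (sylvesterInsert a u).Pairwise r := by
  induction u with
  | nil => simp [sylvesterInsert]
  | cons z y ih =>
    obtain ⟨hz, hy⟩ := List.pairwise_cons.1 hu
    obtain ⟨haz, hay⟩ := List.forall_mem_cons.1 ha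
    rw [sylvesterInsert]
    split_ifs
    · refine List.pairwise_cons.2 ⟨fun x hx => ?_, ih hy hay⟩
      obtain rfl | hx := mem_sylvesterInsert.1 hx
      exacts [haz.1, hz x hx]
    · exact List.pairwise_cons.2 ⟨fun x hx => (ha x hx).2, hu⟩

theorem IsSylvesterNormal.sylvesterInsert {u : List α} (hu : IsSylvesterNormal u) (a : α) :
    IsSylvesterNormal (sylvesterInsert a u) := by
  induction u with
  | nil => exact List.triplewise_singleton ..
  | cons z y ih =>
    obtain ⟨hz, hy⟩ := List.triplewise_cons.1 hu
    rw [_root_.sylvesterInsert]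
    split_ifs with h
    · obtain ⟨b, -, hzb, hba⟩ := h
      have hza : z ≤ a := hzb.trans hba.le
      exact List.triplewise_cons.2
        ⟨pairwise_sylvesterInsert hz fun x _ => ⟨fun _ => hza, hza.trans⟩, ih hy⟩
    · push Not at h
      refine List.triplewise_cons.2 ⟨List.pairwise_cons.2 ⟨h, ?_⟩, hu⟩
      exact hz.imp_of_mem fun _ hq hzq hpq => h _ hq (hzq hpq)

theorem sylvesterInsert_comm {a b c : α} {u : List α} (hab : a ≤ b) (hbc : b < c) (hb : b ∈ u) :
    sylvesterInsert c (sylvesterInsert a u) = sylvesterInsert a (sylvesterInsert c u) := by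
  have hac : a < c := hab.trans_lt hbc
  induction u with
  | nil => simp at hb
  | cons z y ih =>
    have hca : ∃ d ∈ z :: y, a ≤ d ∧ d < c := ⟨b, hb, hab, hbc⟩
    by_cases hc : ∃ d ∈ y, z ≤ d ∧ d < c
    · by_cases ha : ∃ d ∈ y, z ≤ d ∧ d < a
      · obtain ⟨d, hd, hzd, hda⟩ := ha
        have hby : b ∈ y := (List.mem_cons.1 hb).resolve_left fun h => by
          exact (hda.trans_le (hab.trans_eq h)).not_ge hzd
        have hc' : ∃ d ∈ sylvesterInsert a y, z ≤ d ∧ d < c :=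
          ⟨d, mem_sylvesterInsert.2 (.inr hd), hzd, hda.trans hac⟩
        have ha' : ∃ d ∈ sylvesterInsert c y, z ≤ d ∧ d < a :=
          ⟨d, mem_sylvesterInsert.2 (.inr hd), hzd, hda⟩
        have ha : ∃ d ∈ y, z ≤ d ∧ d < a := ⟨d, hd, hzd, hda⟩
        simp only [sylvesterInsert, if_pos ha, if_pos hc, if_pos ha', if_pos hc', ih hby]
      · have ha' : ¬ ∃ d ∈ sylvesterInsert c y, z ≤ d ∧ d < a := by
          rintro ⟨d, hd, hzd, hda⟩
          obtain rfl | hd := mem_sylvesterInsert.1 hd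
          exacts [hac.not_gt hda, ha ⟨d, hd, hzd, hda⟩]
        simp only [sylvesterInsert, if_pos hc, if_pos hca, if_neg ha, if_neg ha']
    · have ha : ¬ ∃ d ∈ y, z ≤ d ∧ d < a := fun ⟨d, hd, hzd, hda⟩ =>
        hc ⟨d, hd, hzd, hda.trans hac⟩
      have ha' : ¬ ∃ d ∈ z :: y, c ≤ d ∧ d < a := fun ⟨d, _, hcd, hda⟩ =>
        (hac.trans_le hcd).not_gt hda
      simp only [sylvesterInsert, if_pos hca, if_neg hc, if_neg ha, if_neg ha']

theorem exists_sylvesterInsert_eq (a : α) (u : List α) :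
    ∃ s t, u = s ++ t ∧ sylvesterInsert a u = s ++ a :: t ∧
      (s = [] ∨ ∃ b ∈ t, b < a ∧ ∀ x ∈ s, x ≤ b) := by
  induction u with
  | nil => exact ⟨[], [], rfl, rfl, .inl rfl⟩
  | cons z y ih =>
    rw [sylvesterInsert]
    split_ifs with h
    · obtain ⟨b, hb, hzb, hba⟩ := h
      obtain ⟨s, t, rfl, hst, rfl | ⟨b', hb', hb'a, hs⟩⟩ := ih
      · exact ⟨[z], t, rfl, by rw [hst]; rfl, .inr ⟨b, hb, hba, by simpa using hzb⟩⟩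
      · refine ⟨z :: s, t, rfl, by rw [hst]; rfl, .inr ?_⟩
        obtain hb | hb := List.mem_append.1 hb
        · exact ⟨b', hb', hb'a, List.forall_mem_cons.2 ⟨hzb.trans (hs b hb), hs⟩⟩
        · obtain hle | hle := le_total b b'
          · exact ⟨b', hb', hb'a, List.forall_mem_cons.2 ⟨hzb.trans hle, hs⟩⟩
          · exact ⟨b, hb, hba, List.forall_mem_cons.2 ⟨hzb, fun x hx => (hs x hx).trans hle⟩⟩
    · exact ⟨[], z :: y, rfl, rfl, .inl rfl⟩

theorem sylvesterInsert_append {a b : α} {s t : List α} (hs : ∀ x ∈ s, x ≤ b) (hb : b ∈ t)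
    (hba : b < a) : sylvesterInsert a (s ++ t) = s ++ sylvesterInsert a t := by
  induction s with
  | nil => rfl
  | cons z s ih =>
    obtain ⟨hz, hs⟩ := List.forall_mem_cons.1 hs
    rw [List.cons_append, sylvesterInsert, if_pos ⟨b, List.mem_append_right s hb, hz, hba⟩, ih hs,
      List.cons_append]

theorem IsSylvesterNormal.foldr_sylvesterInsert {u : List α} (hu : IsSylvesterNormal u) :
    u.foldr _root_.sylvesterInsert [] = u := by
  induction u with
  | nil => rfl
  | cons a u ih =>
    rw [List.foldr_cons, ih (hu.sublist (List.sublist_cons_self a u)), hu.sylvesterInsert_eq_cons]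

theorem isSylvesterNormal_foldr_sylvesterInsert (u : List α) :
    IsSylvesterNormal (u.foldr sylvesterInsert []) := by
  induction u with
  | nil => exact .nil
  | cons a u ih => exact ih.sylvesterInsert a

/-- The letters at most `a` of a word followed by its letters greater than `a`, each in their
original order: on normal forms this is multiplication by `a` on the right, without the last
letter `a`. -/
def partitionLE (a : α) (u : List α) : List α :=
  u.filter (· ≤ a) ++ u.filter (a < ·)

theorem filter_not_le (a : α) (u : List α) : u.filter (fun x => !decide (x ≤ a)) =
    u.filter (a < ·) := by
  simp only [← decide_not, not_le]

theorem IsSylvesterNormal.partitionLE_append_singleton {u : List α} (hu : IsSylvesterNormal u)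
    (a : α) : IsSylvesterNormal (partitionLE a u ++ [a]) := by
  have hle : ∀ x ∈ u.filter (· ≤ a), x ≤ a := fun x hx => by simpa using (List.mem_filter.1 hx).2
  have hlt : ∀ x ∈ u.filter (a < ·), a < x := fun x hx => by simpa using (List.mem_filter.1 hx).2
  have hpartition : IsSylvesterNormal (partitionLE a u) := by
    refine List.triplewise_append.2 ⟨hu.sublist List.filter_sublist,
      hu.sublist List.filter_sublist, fun x hx => ?_, fun z hz => ?_⟩
    · exact List.pairwise_of_forall_mem_list fun _ _ b hb _ => (hle x hx).trans (hlt b hb).le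
    · exact List.pairwise_of_forall_mem_list fun x hx _ _ _ => (hle x hx).trans (hlt z hz).le
  have hlast : (partitionLE a u).Pairwise fun c x => x ≤ a → c ≤ a := by
    refine List.pairwise_append.2 ⟨?_, ?_, fun x hx _ _ _ => hle x hx⟩
    · exact List.pairwise_of_forall_mem_list fun x hx _ _ _ => hle x hx
    · exact List.pairwise_of_forall_mem_list fun _ _ y hy hya => ((hlt y hy).not_ge hya).elim
  exact List.triplewise_append.2
    ⟨hpartition, List.triplewise_singleton .., fun _ _ => List.pairwise_singleton .., by simpa⟩

theorem IsSylvesterNormal.nodup_filter_le {a d : α} {t : List α} (h : IsSylvesterNormal (d :: t))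
    (had : a < d) : (t.filter (· ≤ a)).Nodup := by
  refine ((List.triplewise_cons.1 h).1.filter _).imp_of_mem fun {x y} _ hy hxy hne => ?_
  have hya : y ≤ a := by simpa using (List.mem_filter.1 hy).2
  exact (hxy hne.le).not_gt (hya.trans_lt had)

theorem IsSylvesterNormal.exists_append_length_filter_le [Fintype α] {u : List α}
    (hu : IsSylvesterNormal u) (a : α) :
    ∃ s t, u = s ++ t ∧ (∀ x ∈ s, x ≤ a) ∧ (t.filter (· ≤ a)).length ≤ Fintype.card α := by
  induction u with
  | nil => exact ⟨[], [], rfl, by simp, by simp⟩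
  | cons d t ih =>
    obtain hda | had := le_or_gt d a
    · obtain ⟨s, t, rfl, hs, ht⟩ := ih (hu.sublist (List.sublist_cons_self d t))
      exact ⟨d :: s, t, rfl, List.forall_mem_cons.2 ⟨hda, hs⟩, ht⟩
    · refine ⟨[], d :: t, rfl, by simp, ?_⟩
      rw [List.filter_cons_of_neg (by simpa using had)]
      exact (hu.nodup_filter_le had).length_le_card

theorem isRegular_isSylvesterNormal [Finite α] :
    Language.IsRegular {u : List α | IsSylvesterNormal u} :=
  isRegular_triplewise _

theorem syncRegular_partitionLE [Finite α] (a : α) :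
    SyncRegular ((fun u => (u, partitionLE a u)) '' {u | IsSylvesterNormal u}) := by
  have := Fintype.ofFinite α
  simpa only [partitionLE, filter_not_le] using SyncRegular.partition_filter (· ≤ a)
    (Fintype.card α) isRegular_isSylvesterNormal fun u hu => by
      simpa using IsSylvesterNormal.exists_append_length_filter_le hu a

theorem syncRegular_cons_sylvesterInsert [Finite α] (a : α) :
    SyncRegular ((fun u => (a :: u, sylvesterInsert a u)) '' {u | IsSylvesterNormal u}) := by
  convert ((SyncRegular.diagonal isRegular_univ).union (.iUnion fun b : {b // b < a} =>
    (SyncRegular.rotation (isRegular_forall_mem (· ≤ b.1)) [a]).append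
      (.diagonal (isRegular_setOf_mem b.1)))).restrict
    (isRegular_mul (isRegular_singleton [a]) isRegular_isSylvesterNormal)
    isRegular_isSylvesterNormal
  ext p
  constructor
  · rintro ⟨u, hu, rfl⟩
    refine ⟨?_, ⟨[a], rfl, u, hu, rfl⟩, hu.sylvesterInsert a⟩
    obtain ⟨s, t, rfl, hst, rfl | ⟨b, hb, hba, hs⟩⟩ := exists_sylvesterInsert_eq a u
    · exact .inl ⟨_, trivial, Prod.ext rfl hst.symm⟩
    · exact .inr (Set.mem_iUnion.2
        ⟨⟨b, hba⟩, _, ⟨s, hs, rfl⟩, _, ⟨t, hb, rfl⟩, by simp [hst]⟩)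
  · rintro ⟨hp, ⟨_, rfl, u, hu, hpu⟩, hp'⟩
    refine ⟨u, hu, Prod.ext hpu ?_⟩
    obtain ⟨w, -, rfl⟩ | hp := hp
    · obtain rfl : a :: u = w := hpu
      exact hp'.sylvesterInsert_eq_cons
    · obtain ⟨⟨b, hba⟩, _, ⟨s, hs, rfl⟩, _, ⟨t, hb, rfl⟩, rfl⟩ := Set.mem_iUnion.1 hp
      obtain rfl : u = s ++ t := by simpa using hpu
      have hat : IsSylvesterNormal (a :: t) :=
        hp'.sublist (by simp)
      simp [sylvesterInsert_append hs hb hba, hat.sylvesterInsert_eq_cons]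

end SylvesterInsert

/-! ### The biautomatic structure of the sylvester monoid -/

section SylvesterMonoid

variable {M A : Type*} [Monoid M]

theorem wordEval_cons (f : A → M) (a : A) (u : List A) :
    wordEval f (a :: u) = f a * wordEval f u :=
  List.prod_cons

theorem rightMulRel_eq_image {f : A → M} {L : Language A} (hf : Set.InjOn (wordEval f) L)
    {x : List A} {r : List A → List A} (hr : ∀ u ∈ L, r u ∈ L)
    (heval : ∀ u ∈ L, wordEval f (r u) = wordEval f (u ++ x)) :
    rightMulRel f L x = (fun u => (u, r u)) '' L := by
  ext ⟨u, v⟩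
  constructor
  · rintro ⟨hu, hv, h⟩
    exact ⟨u, hu, Prod.ext rfl (hf (hr u hu) hv ((heval u hu).trans h))⟩
  · rintro ⟨u, hu, huv⟩
    obtain ⟨rfl, rfl⟩ := Prod.mk.inj huv
    exact ⟨hu, hr u hu, (heval u hu).symm⟩

theorem leftMulRel_eq_image {f : A → M} {L : Language A} (hf : Set.InjOn (wordEval f) L)
    {x : List A} {l : List A → List A} (hl : ∀ u ∈ L, l u ∈ L)
    (heval : ∀ u ∈ L, wordEval f (l u) = wordEval f (x ++ u)) :
    leftMulRel f L x = (fun u => (u, l u)) '' L := by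
  ext ⟨u, v⟩
  constructor
  · rintro ⟨hu, hv, h⟩
    exact ⟨u, hu, Prod.ext rfl (hf (hl u hu) hv ((heval u hu).trans h))⟩
  · rintro ⟨u, hu, huv⟩
    obtain ⟨rfl, rfl⟩ := Prod.mk.inj huv
    exact ⟨hu, hl u hu, (heval u hu).symm⟩

theorem rightMulRel_nil {f : A → M} {L : Language A} (hf : Set.InjOn (wordEval f) L) :
    rightMulRel f L [] = (fun u => (u, u)) '' L :=
  rightMulRel_eq_image hf (fun _ => id) fun u _ => by rw [List.append_nil]

theorem leftMulRel_nil {f : A → M} {L : Language A} (hf : Set.InjOn (wordEval f) L) :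
    leftMulRel f L [] = (fun u => (u, u)) '' L :=
  leftMulRel_eq_image hf (fun _ => id) fun _ _ => rfl

variable {n : ℕ}

theorem mem_sylvesterNormalForms_iff {w : List (Fin n)} :
    w ∈ sylvesterNormalForms n ↔ IsSylvesterNormal w := by
  induction w with
  | nil =>
    refine ⟨fun _ => .nil, fun _ a b c v _ _ h => ?_⟩
    simpa using h.length_le
  | cons x w ih =>
    rw [IsSylvesterNormal, List.triplewise_cons, ← IsSylvesterNormal, ← ih]
    constructor
    · intro h
      have hw : w ∈ sylvesterNormalForms n := fun a b c v hab hbc hinf =>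
        h a b c v hab hbc (hinf.trans (List.suffix_cons x w).isInfix)
      refine ⟨?_, hw⟩
      obtain _ | ⟨y, w⟩ := w
      · exact .nil
      · have hxy : ∀ b ∈ w, y ≤ b → x ≤ b := by
          intro b hb hyb
          obtain ⟨v, r, rfl⟩ := List.append_of_mem hb
          exact not_lt.1 fun hbx => h y b x v hyb hbx ⟨[], r, by simp⟩
        refine List.pairwise_cons.2 ⟨hxy, ?_⟩
        exact (List.triplewise_cons.1 (ih.1 hw)).1.imp_of_mem
          fun _ hb hyb' hab => hxy _ hb (hyb' hab)
    · rintro ⟨hx, hw⟩ a b c v hab hbc hinf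
      obtain h | h := List.infix_cons_iff.1 hinf
      · obtain ⟨rfl, hpre⟩ := List.cons_prefix_cons.1 (h : c :: (a :: v ++ [b]) <+: x :: w)
        have hp := List.Pairwise.sublist hpre.sublist hx
        exact ((List.pairwise_cons.1 hp).1 b (by simp) hab).not_gt hbc
      · exact hw a b c v hab hbc h

theorem sylvesterNormalForms_eq :
    sylvesterNormalForms n = {w : List (Fin n) | IsSylvesterNormal w} :=
  Set.ext fun _ => mem_sylvesterNormalForms_iff

theorem isRegular_sylvesterNormalForms : (sylvesterNormalForms n).IsRegular :=
  sylvesterNormalForms_eq ▸ isRegular_isSylvesterNormal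

theorem mem_foldr_sylvesterInsert {b : Fin n} {w : List (Fin n)} (hb : b ∈ w)
    (u : List (Fin n)) : b ∈ u.foldr sylvesterInsert w := by
  induction u with
  | nil => exact hb
  | cons a u ih => exact mem_sylvesterInsert.2 (.inr ih)

theorem freeMonoidLift_end_apply {X : Type*} (f : A → Function.End X) (v : FreeMonoid A) (x : X) :
    FreeMonoid.lift f v x = v.toList.foldr f x := by
  induction v using FreeMonoid.inductionOn' with
  | one => rfl
  | of_mul a v ih =>
    rw [map_mul, FreeMonoid.lift_eval_of]
    exact congrArg (f a) ih

/-- The action of the sylvester monoid on words in which each letter acts by left insertion. On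
words in normal form, it is the left regular representation. -/
def sylvesterAction (n : ℕ) : SylvesterMonoid n →* Function.End (List (Fin n)) :=
  PresentedMonoid.lift (M := Function.End (List (Fin n))) sylvesterInsert <| by
    rintro _ _ ⟨a, b, c, v, hab, hbc⟩
    funext w
    have hb : b ∈ v.toList.foldr sylvesterInsert (sylvesterInsert b w) :=
      mem_foldr_sylvesterInsert (mem_sylvesterInsert.2 (.inl rfl)) v.toList
    refine (freeMonoidLift_end_apply _ _ w).trans
      (.trans ?_ (freeMonoidLift_end_apply _ _ w).symm)
    simpa using sylvesterInsert_comm hab hbc hb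

theorem sylvesterAction_wordEval (u w : List (Fin n)) :
    sylvesterAction n (wordEval (sylvesterGen n) u) w = u.foldr sylvesterInsert w := by
  induction u with
  | nil => exact congrFun (map_one (sylvesterAction n)) w
  | cons a u ih =>
    rw [wordEval_cons, map_mul, List.foldr_cons, ← ih]
    rfl

theorem injOn_wordEval_sylvesterNormalForms :
    Set.InjOn (wordEval (sylvesterGen n)) (sylvesterNormalForms n) := by
  intro u hu v hv h
  rw [← (mem_sylvesterNormalForms_iff.1 hu).foldr_sylvesterInsert, ← sylvesterAction_wordEval, h,
    sylvesterAction_wordEval, (mem_sylvesterNormalForms_iff.1 hv).foldr_sylvesterInsert]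

theorem wordEval_sylvesterGen (u : List (Fin n)) :
    wordEval (sylvesterGen n) u = PresentedMonoid.mk (SylvesterRel n) (FreeMonoid.ofList u) := by
  induction u with
  | nil => rfl
  | cons a u ih => rw [wordEval_cons, ih]; rfl

theorem wordEval_swap {a b c : Fin n} (hab : a ≤ b) (hbc : b < c) {q : List (Fin n)} (hb : b ∈ q) :
    wordEval (sylvesterGen n) (c :: a :: q) = wordEval (sylvesterGen n) (a :: c :: q) := by
  obtain ⟨v, r, rfl⟩ := List.append_of_mem hb
  have hrel : wordEval (sylvesterGen n) (c :: a :: v ++ [b]) =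
      wordEval (sylvesterGen n) (a :: c :: v ++ [b]) := by
    rw [wordEval_sylvesterGen, wordEval_sylvesterGen]
    exact PresentedMonoid.mk_eq_mk_of_rel (SylvesterRel.intro a b c v hab hbc)
  simpa [wordEval, mul_assoc] using congrArg (· * wordEval (sylvesterGen n) r) hrel

theorem wordEval_slide {b c : Fin n} {D q : List (Fin n)} (hbc : b < c) (hD : ∀ d ∈ D, d ≤ b)
    (hb : b ∈ q) :
    wordEval (sylvesterGen n) (c :: (D ++ q)) = wordEval (sylvesterGen n) (D ++ c :: q) := by
  induction D with
  | nil => rfl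
  | cons d D ih =>
    obtain ⟨hd, hD⟩ := List.forall_mem_cons.1 hD
    rw [List.cons_append, wordEval_swap hd hbc (List.mem_append_right D hb), wordEval_cons, ih hD,
      List.cons_append, wordEval_cons]

theorem wordEval_sylvesterInsert (a : Fin n) (u : List (Fin n)) :
    wordEval (sylvesterGen n) (sylvesterInsert a u) = wordEval (sylvesterGen n) (a :: u) := by
  obtain ⟨s, t, rfl, hst, rfl | ⟨b, hb, hba, hs⟩⟩ := exists_sylvesterInsert_eq a u
  · rw [hst]
    rfl
  · rw [hst, wordEval_slide hba hs hb]

theorem wordEval_foldr_sylvesterInsert (u : List (Fin n)) :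
    wordEval (sylvesterGen n) (u.foldr sylvesterInsert []) = wordEval (sylvesterGen n) u := by
  induction u with
  | nil => rfl
  | cons a u ih => rw [List.foldr_cons, wordEval_sylvesterInsert, wordEval_cons, ih, wordEval_cons]

theorem exists_mem_sylvesterNormalForms_wordEval_eq (m : SylvesterMonoid n) :
    ∃ u ∈ sylvesterNormalForms n, wordEval (sylvesterGen n) u = m := by
  obtain ⟨w, rfl⟩ := PresentedMonoid.surjective_mk m
  exact ⟨_, mem_sylvesterNormalForms_iff.2 (isSylvesterNormal_foldr_sylvesterInsert w.toList),
    (wordEval_foldr_sylvesterInsert _).trans (wordEval_sylvesterGen _)⟩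

theorem wordEval_partitionLE_append_singleton (a : Fin n) (u : List (Fin n)) :
    wordEval (sylvesterGen n) (partitionLE a u ++ [a]) = wordEval (sylvesterGen n) (u ++ [a]) := by
  induction u with
  | nil => rfl
  | cons x u ih =>
    rw [List.cons_append, wordEval_cons, ← ih, ← wordEval_cons]
    obtain hxa | hax := le_or_gt x a
    · simp [partitionLE, hxa, hxa.not_gt]
    · have hslide := wordEval_slide (D := u.filter (· ≤ a)) (q := u.filter (a < ·) ++ [a]) hax
        (fun d hd => by simpa using (List.mem_filter.1 hd).2) (by simp)
      simpa [partitionLE, hax, hax.not_ge] using hslide.symm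

theorem rightMulRel_sylvesterGen (a : Fin n) :
    rightMulRel (sylvesterGen n) (sylvesterNormalForms n) [a] =
      (fun u => (u, partitionLE a u ++ [a])) '' {u | IsSylvesterNormal u} := by
  rw [← sylvesterNormalForms_eq]
  exact rightMulRel_eq_image injOn_wordEval_sylvesterNormalForms
    (fun u hu => mem_sylvesterNormalForms_iff.2
      ((mem_sylvesterNormalForms_iff.1 hu).partitionLE_append_singleton a))
    fun u _ => wordEval_partitionLE_append_singleton a u

theorem leftMulRel_sylvesterGen (a : Fin n) :
    leftMulRel (sylvesterGen n) (sylvesterNormalForms n) [a] =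
      (fun u => (u, sylvesterInsert a u)) '' {u | IsSylvesterNormal u} := by
  rw [← sylvesterNormalForms_eq]
  exact leftMulRel_eq_image injOn_wordEval_sylvesterNormalForms
    (fun u hu => mem_sylvesterNormalForms_iff.2
      ((mem_sylvesterNormalForms_iff.1 hu).sylvesterInsert a))
    fun u _ => wordEval_sylvesterInsert a u

theorem syncRegular_rightMulRel_sylvesterGen (a : Option (Fin n)) :
    SyncRegular (Prod.map (· ++ a.toList) id ''
      rightMulRel (sylvesterGen n) (sylvesterNormalForms n) a.toList) := by
  obtain _ | a := a
  · simpa [rightMulRel_nil injOn_wordEval_sylvesterNormalForms, Prod.map, Set.image_image] using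
      SyncRegular.diagonal isRegular_sylvesterNormalForms
  · have happend := (syncRegular_partitionLE a).append (.singleton (rfl : [a].length = [a].length))
    simpa [rightMulRel_sylvesterGen, appendRel, Set.image_image] using happend

theorem syncRegular_leftMulRel_sylvesterGen (a : Option (Fin n)) :
    SyncRegular (Prod.map (a.toList ++ ·) id ''
      leftMulRel (sylvesterGen n) (sylvesterNormalForms n) a.toList) := by
  obtain _ | a := a
  · simpa [leftMulRel_nil injOn_wordEval_sylvesterNormalForms, Prod.map, Set.image_image] using
      SyncRegular.diagonal isRegular_sylvesterNormalForms
  · simpa [leftMulRel_sylvesterGen, Set.image_image] using syncRegular_cons_sylvesterInsert a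

end SylvesterMonoid

theorem mainTheorem7 (n : ℕ) :
    IsBiautomaticStructure (sylvesterGen n) (sylvesterNormalForms n) :=
  isBiautomaticStructure_of_syncRegular (PresentedMonoid.closure_range_of _)
    isRegular_sylvesterNormalForms exists_mem_sylvesterNormalForms_wordEval_eq
    syncRegular_rightMulRel_sylvesterGen syncRegular_leftMulRel_sylvesterGen
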